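/- Let $M=\{v_n\}_{n=1}^\infty$ be a countable set of distinct points equipped with one of the following five metrics, given for $n>k\ge 1$ by (a) $\rho(v_k,v_n)=k+n-\frac1k$; (b) $\rho(v_k,v_n)=2-\frac1k+\frac1n$; (c) $\rho(v_k,v_n)=2-\frac1k-\frac1{2n}$; (d) $\rho(v_k,v_n)=1+\frac1n$; (e) $\rho(v_k,v_n)=1+\frac1{2k}+\frac1n$ (extended by symmetry and $\rho(v_n,v_n)=0$). Let $\mathrm{tc}(M)$ denote the transportation cost space of $M$, that is, the completion of the real vector space of finitely supported functions $f:M\to\mathbb R$ with $\sum_{v}f(v)=0$ with respect to the norm $$\|f\|_{\mathrm{tc}}=\inf\Big\{\sum_{i=1}^n a_i\,\rho(x_i,y_i)\;:\; f=\sum_{i=1}^n a_i(\mathbf 1_{x_i}-\mathbf 1_{y_i}),\ n\ge 0,\ a_i\ge 0,\ x_i,y_i\in M\Big\},$$ where $\mathbf 1_u$ is the indicator function of $\{u\}$ (this infimum is a minimum). Then, in each of the five cases, $\mathrm{tc}(M)$ contains no isometric copy of the real Banach space $\ell_1$; that is, there is no linear isometric embedding $\ell_1\to\mathrm{tc}(M)$.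 -/

import Mathlib

noncomputable section

/-! ## Transportation cost spaces -/

/-- The real vector space of finitely supported functions on `M` whose values sum to zero. -/
def tpSubmodule (M : Type*) : Submodule ℝ (M →₀ ℝ) :=
  LinearMap.ker (Finsupp.linearCombination ℝ (fun _ : M => (1 : ℝ)))

/-- `TP M`: the space of transportation problems on `M`. It is a type synonym, so that the only
norm on it is the transportation cost norm defined below. -/
def TP (M : Type*) : Type _ := ↥(tpSubmodule M)

namespace TP

variable {M : Type*}

instance : AddCommGroup (TP M) := inferInstanceAs (AddCommGroup ↥(tpSubmodule M))

instance : Module ℝ (TP M) := inferInstanceAs (Module ℝ ↥(tpSubmodule M))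

/-- The finitely supported function underlying a transportation problem, as a linear map. -/
def toFinsupp : TP M →ₗ[ℝ] (M →₀ ℝ) := (tpSubmodule M).subtype

theorem toFinsupp_injective : Function.Injective (toFinsupp (M := M)) :=
  Subtype.val_injective

theorem sum_eq_zero (f : TP M) : (toFinsupp f).sum (fun _ a => a) = 0 := by
  have h : Finsupp.linearCombination ℝ (fun _ : M => (1 : ℝ)) (toFinsupp f) = 0 := f.2
  simpa [Finsupp.linearCombination_apply] using h

end TP

/-- A transportation plan for `f`: a representation
`f = ∑ i, a i • (𝟙_{x i} - 𝟙_{y i})` with all `a i ≥ 0`. -/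
structure TransportPlan {M : Type*} (f : TP M) where
  n : ℕ
  a : Fin n → ℝ
  x : Fin n → M
  y : Fin n → M
  a_nonneg : ∀ i, 0 ≤ a i
  eq_sum : TP.toFinsupp f =
    ∑ i, a i • (Finsupp.single (x i) (1 : ℝ) - Finsupp.single (y i) (1 : ℝ))

namespace TransportPlan

variable {M : Type*}

/-- The cost `∑ i, a i * d (x i, y i)` of a transportation plan. -/
def cost [MetricSpace M] {f : TP M} (P : TransportPlan f) : ℝ :=
  ∑ i, P.a i * dist (P.x i) (P.y i)

theorem cost_nonneg [MetricSpace M] {f : TP M} (P : TransportPlan f) : 0 ≤ P.cost :=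
  Finset.sum_nonneg fun i _ => mul_nonneg (P.a_nonneg i) dist_nonneg

/-- The empty plan for the zero problem. -/
def zero : TransportPlan (0 : TP M) where
  n := 0
  a := Fin.elim0
  x := Fin.elim0
  y := Fin.elim0
  a_nonneg := fun i => i.elim0
  eq_sum := by simp

/-- Performing two plans one after the other. -/
def add {f g : TP M} (P : TransportPlan f) (Q : TransportPlan g) : TransportPlan (f + g) where
  n := P.n + Q.n
  a := Fin.append P.a Q.a
  x := Fin.append P.x Q.x
  y := Fin.append P.y Q.y
  a_nonneg := fun i => by
    refine Fin.addCases (fun j => ?_) (fun j => ?_) i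
    · simpa using P.a_nonneg j
    · simpa using Q.a_nonneg j
  eq_sum := by
    rw [map_add, P.eq_sum, Q.eq_sum, Fin.sum_univ_add]
    simp

theorem cost_add [MetricSpace M] {f g : TP M} (P : TransportPlan f) (Q : TransportPlan g) :
    (P.add Q).cost = P.cost + Q.cost := by
  change (∑ i : Fin (P.n + Q.n), Fin.append P.a Q.a i *
    dist (Fin.append P.x Q.x i) (Fin.append P.y Q.y i)) = _
  rw [Fin.sum_univ_add]
  simp [cost]

/-- Rescaling a plan by a nonnegative factor. -/
def smul {f : TP M} (c : ℝ) (hc : 0 ≤ c) (P : TransportPlan f) : TransportPlan (c • f) where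
  n := P.n
  a := fun i => c * P.a i
  x := P.x
  y := P.y
  a_nonneg := fun i => mul_nonneg hc (P.a_nonneg i)
  eq_sum := by
    rw [map_smul, P.eq_sum, Finset.smul_sum]
    simp only [mul_smul]

theorem cost_smul [MetricSpace M] {f : TP M} (c : ℝ) (hc : 0 ≤ c) (P : TransportPlan f) :
    (P.smul c hc).cost = c * P.cost := by
  change (∑ i : Fin P.n, c * P.a i * dist (P.x i) (P.y i)) = _
  simp only [cost, Finset.mul_sum, mul_assoc]

/-- Reversing a plan. -/
def neg {f : TP M} (P : TransportPlan f) : TransportPlan (-f) where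
  n := P.n
  a := P.a
  x := P.y
  y := P.x
  a_nonneg := P.a_nonneg
  eq_sum := by
    rw [map_neg, P.eq_sum, ← Finset.sum_neg_distrib]
    refine Finset.sum_congr rfl fun i _ => ?_
    rw [← smul_neg, neg_sub]

theorem cost_neg [MetricSpace M] {f : TP M} (P : TransportPlan f) : P.neg.cost = P.cost := by
  change (∑ i : Fin P.n, P.a i * dist (P.y i) (P.x i)) = _
  simp only [cost, dist_comm]

/-- Every transportation problem has a transportation plan. -/
theorem nonempty (f : TP M) : Nonempty (TransportPlan f) := by
  classical
  rcases isEmpty_or_nonempty M with hM | ⟨⟨o⟩⟩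
  · have : f = 0 := TP.toFinsupp_injective (Subsingleton.elim _ _)
    exact this ▸ ⟨zero⟩
  set F := TP.toFinsupp f with hF
  let e := F.support.equivFin
  refine ⟨⟨F.support.card, fun i => |F (e.symm i)|,
    fun i => if 0 ≤ F (e.symm i) then (e.symm i : M) else o,
    fun i => if 0 ≤ F (e.symm i) then o else (e.symm i : M), fun i => abs_nonneg _, ?_⟩⟩
  have key : ∀ u : M, |F u| • (Finsupp.single (if 0 ≤ F u then u else o) (1 : ℝ) -
      Finsupp.single (if 0 ≤ F u then o else u) (1 : ℝ)) =
      Finsupp.single u (F u) - Finsupp.single o (F u) := by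
    intro u
    by_cases h : 0 ≤ F u
    · simp [h, abs_of_nonneg h, smul_sub]
    · simp [h, abs_of_neg (not_le.mp h), smul_sub]
      abel
  simp only [key]
  rw [Equiv.sum_comp e.symm
    (fun u : F.support => Finsupp.single (u : M) (F u) - Finsupp.single o (F u)),
    Finset.sum_coe_sort F.support (fun u => Finsupp.single u (F u) - Finsupp.single o (F u)),
    Finset.sum_sub_distrib, ← Finsupp.single_finsetSum]
  have h0 : ∑ u ∈ F.support, F u = 0 := TP.sum_eq_zero f
  rw [h0, Finsupp.single_zero, sub_zero]
  exact F.sum_single.symm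

instance (f : TP M) : Nonempty (TransportPlan f) := nonempty f

/-- A plan for `f` costs at least `∑ u, f u * h u` for every `1`-Lipschitz function `h`. -/
theorem sum_le_cost [MetricSpace M] {f : TP M} (P : TransportPlan f) (h : M → ℝ)
    (hh : ∀ u v, h u - h v ≤ dist u v) :
    Finsupp.linearCombination ℝ h (TP.toFinsupp f) ≤ P.cost := by
  rw [P.eq_sum, map_sum, cost]
  refine Finset.sum_le_sum fun i _ => ?_
  simp only [map_smul, map_sub, Finsupp.linearCombination_single, smul_eq_mul, one_mul]
  exact mul_le_mul_of_nonneg_left (hh _ _) (P.a_nonneg i)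

end TransportPlan

namespace TP

variable {M : Type*} [MetricSpace M]

/-- The transportation cost norm: the minimal cost of a transportation plan. -/
def tcNorm (f : TP M) : ℝ := ⨅ P : TransportPlan f, P.cost

theorem tcNorm_le {f : TP M} (P : TransportPlan f) : tcNorm f ≤ P.cost :=
  ciInf_le ⟨0, by rintro _ ⟨Q, rfl⟩; exact Q.cost_nonneg⟩ P

theorem tcNorm_nonneg (f : TP M) : 0 ≤ tcNorm f := le_ciInf fun P => P.cost_nonneg

theorem tcNorm_zero : tcNorm (0 : TP M) = 0 := by
  refine le_antisymm ((tcNorm_le TransportPlan.zero).trans_eq ?_) (tcNorm_nonneg _)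
  simp [TransportPlan.cost, TransportPlan.zero]

theorem tcNorm_add_le (f g : TP M) : tcNorm (f + g) ≤ tcNorm f + tcNorm g := by
  refine le_ciInf_add_ciInf fun P Q => ?_
  rw [← TransportPlan.cost_add]
  exact tcNorm_le _

theorem tcNorm_neg (f : TP M) : tcNorm (-f) = tcNorm f := by
  have key : ∀ g : TP M, tcNorm (-g) ≤ tcNorm g := fun g =>
    le_ciInf fun P => (tcNorm_le P.neg).trans_eq P.cost_neg
  refine le_antisymm (key f) ?_
  simpa using key (-f)

theorem tcNorm_smul_le (c : ℝ) (f : TP M) : tcNorm (c • f) ≤ |c| * tcNorm f := by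
  have key : ∀ (b : ℝ), 0 ≤ b → tcNorm (b • f) ≤ b * tcNorm f := fun b hb => by
    rw [tcNorm, tcNorm, Real.mul_iInf_of_nonneg hb]
    exact le_ciInf fun P => (tcNorm_le (P.smul b hb)).trans_eq (P.cost_smul b hb)
  rcases le_total 0 c with hc | hc
  · rw [abs_of_nonneg hc]
    exact key c hc
  · rw [abs_of_nonpos hc, ← tcNorm_neg, ← neg_smul]
    exact key (-c) (neg_nonneg.mpr hc)

theorem eq_zero_of_tcNorm_eq_zero (f : TP M) (hf : tcNorm f = 0) : f = 0 := by
  classical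
  have key : ∀ g : TP M, tcNorm g = 0 → ∀ x, toFinsupp g x ≤ 0 := by
    intro g hg x
    obtain ⟨r, hr, hrs⟩ : ∃ r > 0, ∀ u ∈ (toFinsupp g).support, u ≠ x → r ≤ dist x u := by
      have hfin : ((toFinsupp g).support.erase x : Set M).Finite := Finset.finite_toSet _
      have hx : x ∉ ((toFinsupp g).support.erase x : Set M) := by simp
      obtain ⟨r, hr, hb⟩ := Metric.mem_nhds_iff.mp (hfin.isClosed.isOpen_compl.mem_nhds hx)
      refine ⟨r, hr, fun u hu hux => ?_⟩
      by_contra hlt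
      have : u ∈ Metric.ball x r := by rw [Metric.mem_ball, dist_comm]; exact not_le.mp hlt
      exact hb this (by simp [hux, Finsupp.mem_support_iff.mp hu])
    let h : M → ℝ := fun u => max 0 (r - dist x u)
    have hh : ∀ u v, h u - h v ≤ dist u v := by
      intro u v
      have h1 : 0 ≤ h v := le_max_left _ _
      have h2 : r - dist x v ≤ h v := le_max_right _ _
      have h3 := dist_triangle x u v
      have : h u ≤ h v + dist u v :=
        max_le (by have := dist_nonneg (x := u) (y := v); linarith) (by linarith)
      linarith
    have hval : Finsupp.linearCombination ℝ h (toFinsupp g) = toFinsupp g x * r := by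
      rw [Finsupp.linearCombination_apply, Finsupp.sum, Finset.sum_eq_single x]
      · simp [h, hr.le]
      · intro u hu hux
        have := hrs u hu hux
        simp [h, this]
      · intro hx
        simp [Finsupp.notMem_support_iff.mp hx]
    have hle : toFinsupp g x * r ≤ tcNorm g :=
      le_ciInf fun P => hval ▸ P.sum_le_cost h hh
    rw [hg] at hle
    exact nonpos_of_mul_nonpos_left hle hr
  apply toFinsupp_injective
  ext x
  have h1 := key f hf x
  have h2 := key (-f) (by rw [tcNorm_neg, hf]) x
  simp only [map_neg, Finsupp.neg_apply] at h2
  simp only [map_zero, Finsupp.coe_zero, Pi.zero_apply]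
  linarith

instance : NormedAddCommGroup (TP M) :=
  AddGroupNorm.toNormedAddCommGroup
    { toFun := tcNorm
      map_zero' := tcNorm_zero
      add_le' := tcNorm_add_le
      neg' := tcNorm_neg
      eq_zero_of_map_eq_zero' := eq_zero_of_tcNorm_eq_zero }

theorem norm_def (f : TP M) : ‖f‖ = ⨅ P : TransportPlan f, P.cost := rfl

instance : NormedSpace ℝ (TP M) where
  norm_smul_le := tcNorm_smul_le

end TP

/-- The transportation cost space `tc(M)`: the completion of the space of transportation problems
with respect to the transportation cost norm. -/
abbrev TC (M : Type*) [MetricSpace M] : Type _ := UniformSpace.Completion (TP M)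

/-! ## The five metric spaces -/

/-- Labels of the five examples. -/
inductive CJLabel where
  | a | b | c | d | e

/-- The distance `ρ(v_k, v_n)` for `k < n`, in each of the five cases. -/
def CJLabel.rho : CJLabel → ℝ → ℝ → ℝ
  | .a, k, n => k + n - 1 / k
  | .b, k, n => 2 - 1 / k + 1 / n
  | .c, k, n => 2 - 1 / k - 1 / (2 * n)
  | .d, _, n => 1 + 1 / n
  | .e, k, n => 1 + 1 / (2 * k) + 1 / n

/-- The countable set `{v_n : n = 1, 2, …}`, one copy for each label. -/
structure CJSpace (l : CJLabel) where
  v ::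
  idx : ℕ+

namespace CJSpace

/-- The symmetric distance on `CJSpace l` which is given by `rho` for `k < n`. -/
def distFun {l : CJLabel} (p q : CJSpace l) : ℝ :=
  if p.idx < q.idx then l.rho p.idx q.idx
  else if q.idx < p.idx then l.rho q.idx p.idx
  else 0

theorem distFun_of_lt {l : CJLabel} {p q : CJSpace l} (h : p.idx < q.idx) :
    distFun p q = l.rho p.idx q.idx := if_pos h

theorem distFun_comm {l : CJLabel} (p q : CJSpace l) : distFun p q = distFun q p := by
  rcases lt_trichotomy p.idx q.idx with h | h | h
  · simp [distFun, h, h.not_gt]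
  · simp [distFun, h]
  · simp [distFun, h, h.not_gt]

theorem distFun_self {l : CJLabel} (p : CJSpace l) : distFun p p = 0 := by simp [distFun]

theorem rho_pos (l : CJLabel) (k n : ℕ+) : 0 < l.rho k n := by
  have hk : (1 : ℝ) ≤ k := by exact_mod_cast one_le (a := k)
  have hn : (1 : ℝ) ≤ n := by exact_mod_cast one_le (a := n)
  have hk' : 1 / (k : ℝ) ≤ 1 := by rw [div_le_one (by linarith)]; exact hk
  have hn' : 1 / (n : ℝ) ≤ 1 := by rw [div_le_one (by linarith)]; exact hn
  have hk0 : 0 < 1 / (k : ℝ) := by positivity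
  have hn0 : 0 < 1 / (n : ℝ) := by positivity
  cases l <;> simp only [CJLabel.rho, one_div, mul_inv] at * <;> linarith

/-- The three triangle inequalities for `v_i, v_j, v_k` with `i < j < k`. -/
theorem rho_triangle (l : CJLabel) {i j k : ℕ+} (hij : i < j) (hjk : j < k) :
    l.rho i k ≤ l.rho i j + l.rho j k ∧ l.rho i j ≤ l.rho i k + l.rho j k ∧
      l.rho j k ≤ l.rho i j + l.rho i k := by
  have hi : (1 : ℝ) ≤ i := by exact_mod_cast one_le (a := i)
  have hj : (1 : ℝ) ≤ j := by exact_mod_cast one_le (a := j)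
  have hk : (1 : ℝ) ≤ k := by exact_mod_cast one_le (a := k)
  have hi' : 1 / (i : ℝ) ≤ 1 := by rw [div_le_one (by linarith)]; exact hi
  have hij' : 1 / (j : ℝ) ≤ 1 / i :=
    one_div_le_one_div_of_le (by linarith) (by exact_mod_cast hij.le)
  have hjk' : 1 / (k : ℝ) ≤ 1 / j :=
    one_div_le_one_div_of_le (by linarith) (by exact_mod_cast hjk.le)
  have hi0 : 0 < 1 / (i : ℝ) := by positivity
  have hj0 : 0 < 1 / (j : ℝ) := by positivity
  have hk0 : 0 < 1 / (k : ℝ) := by positivity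
  cases l <;> simp only [CJLabel.rho, one_div, mul_inv] at * <;>
    refine ⟨?_, ?_, ?_⟩ <;> linarith

theorem distFun_pos {l : CJLabel} {p q : CJSpace l} (h : p.idx ≠ q.idx) : 0 < distFun p q := by
  rcases lt_or_gt_of_ne h with h | h
  · rw [distFun_of_lt h]
    exact rho_pos l _ _
  · rw [distFun_comm, distFun_of_lt h]
    exact rho_pos l _ _

theorem distFun_nonneg {l : CJLabel} (p q : CJSpace l) : 0 ≤ distFun p q := by
  by_cases h : p.idx = q.idx
  · simp [distFun, h]
  · exact (distFun_pos h).le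

theorem distFun_triangle {l : CJLabel} (p q r : CJSpace l) :
    distFun p r ≤ distFun p q + distFun q r := by
  obtain ⟨p⟩ := p
  obtain ⟨q⟩ := q
  obtain ⟨r⟩ := r
  have hz : ∀ x : CJSpace l, distFun x x = 0 := distFun_self
  rcases eq_or_ne p q with rfl | hpq
  · simp [hz]
  rcases eq_or_ne q r with rfl | hqr
  · simp [hz]
  rcases eq_or_ne p r with rfl | hpr
  · rw [hz]
    exact add_nonneg (distFun_nonneg _ _) (distFun_nonneg _ _)
  rcases lt_or_gt_of_ne hpq with h1 | h1 <;> rcases lt_or_gt_of_ne hqr with h2 | h2 <;>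
    rcases lt_or_gt_of_ne hpr with h3 | h3
  · have := rho_triangle l h1 h2
    simp only [distFun, h1, h2, h3, h1.not_gt, h2.not_gt, h3.not_gt, if_true, if_false]
    linarith
  · exact absurd (h1.trans h2) h3.not_gt
  · have := rho_triangle l h3 h2
    simp only [distFun, h1, h2, h3, h1.not_gt, h2.not_gt, h3.not_gt, if_true, if_false]
    linarith
  · have := rho_triangle l h3 h1
    simp only [distFun, h1, h2, h3, h1.not_gt, h2.not_gt, h3.not_gt, if_true, if_false]
    linarith
  · have := rho_triangle l h1 h3
    simp only [distFun, h1, h2, h3, h1.not_gt, h2.not_gt, h3.not_gt, if_true, if_false]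
    linarith
  · have := rho_triangle l h2 h3
    simp only [distFun, h1, h2, h3, h1.not_gt, h2.not_gt, h3.not_gt, if_true, if_false]
    linarith
  · exact absurd (h2.trans h1) h3.not_gt
  · have := rho_triangle l h2 h1
    simp only [distFun, h1, h2, h3, h1.not_gt, h2.not_gt, h3.not_gt, if_true, if_false]
    linarith

instance (l : CJLabel) : MetricSpace (CJSpace l) where
  dist := distFun
  dist_self := distFun_self
  dist_comm := distFun_comm
  dist_triangle := distFun_triangle
  eq_of_dist_eq_zero := by
    rintro ⟨p⟩ ⟨q⟩ h
    by_contra hne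
    have hpq : p ≠ q := fun h' => hne (by rw [h'])
    exact (distFun_pos (p := CJSpace.v (l := l) p) (q := CJSpace.v q) hpq).ne' h

theorem dist_of_lt (l : CJLabel) {k n : ℕ+} (h : k < n) :
    dist (CJSpace.v k : CJSpace l) (CJSpace.v n) = l.rho k n :=
  distFun_of_lt (p := CJSpace.v (l := l) k) (q := CJSpace.v n) h

end CJSpace

end

noncomputable section

/-! ### Dipoles and Lipschitz potentials on finitely supported problems. -/

namespace TP

variable {M : Type*}

/-- The elementary transportation problem `𝟙_x - 𝟙_y`. -/
def dipole (x y : M) : TP M :=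
  ⟨Finsupp.single x 1 - Finsupp.single y 1, by
    simp [tpSubmodule, LinearMap.mem_ker]⟩

theorem toFinsupp_dipole (x y : M) :
    toFinsupp (dipole x y) = Finsupp.single x 1 - Finsupp.single y 1 := rfl

theorem eq_sum_dipole (g : TP M) (o : M) :
    g = ∑ u ∈ (toFinsupp g).support, toFinsupp g u • dipole u o := by
  apply toFinsupp_injective
  have h0 : ∑ u ∈ (toFinsupp g).support, toFinsupp g u = 0 := TP.sum_eq_zero g
  simp only [map_sum, map_smul, toFinsupp_dipole, smul_sub, Finsupp.smul_single, smul_eq_mul,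
    mul_one, Finset.sum_sub_distrib]
  rw [← Finsupp.single_finsetSum, h0, Finsupp.single_zero, sub_zero]
  exact (toFinsupp g).sum_single.symm

theorem map_eq_linearCombination (L : TP M →ₗ[ℝ] ℝ) (o : M) (g : TP M) :
    L g = Finsupp.linearCombination ℝ (fun u => L (dipole u o)) (toFinsupp g) := by
  conv_lhs => rw [eq_sum_dipole g o]
  simp [Finsupp.linearCombination_apply, Finsupp.sum]

variable [MetricSpace M]

theorem norm_dipole_le (x y : M) : ‖dipole x y‖ ≤ dist x y := by
  let P : TransportPlan (dipole x y) :=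
    ⟨1, fun _ => 1, fun _ => x, fun _ => y, fun _ => zero_le_one, by simp [toFinsupp_dipole]⟩
  refine (tcNorm_le P).trans_eq ?_
  simp [TransportPlan.cost, P]

theorem linearCombination_le_mul_norm {h : M → ℝ} {K : ℝ} (hK : 0 ≤ K)
    (hh : ∀ u v, h u - h v ≤ K * dist u v) (g : TP M) :
    Finsupp.linearCombination ℝ h (toFinsupp g) ≤ K * ‖g‖ := by
  rw [norm_def, Real.mul_iInf_of_nonneg hK]
  refine le_ciInf fun P => ?_
  rw [P.eq_sum, map_sum, TransportPlan.cost, Finset.mul_sum]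
  refine Finset.sum_le_sum fun i _ => ?_
  simp only [map_smul, map_sub, Finsupp.linearCombination_single, smul_eq_mul, one_mul]
  calc P.a i * (h (P.x i) - h (P.y i)) ≤ P.a i * (K * dist (P.x i) (P.y i)) :=
        mul_le_mul_of_nonneg_left (hh _ _) (P.a_nonneg i)
    _ = _ := by ring

end TP

/-! ### Functionals on the completion and point evaluations. -/

namespace TC

open UniformSpace TP

variable {M : Type*} [MetricSpace M]

/-- A `K`-Lipschitz function defines a functional of norm at most `K` on `TC M`. -/
theorem exists_functional (h : M → ℝ) {K : ℝ} (hK : 0 ≤ K)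
    (hh : ∀ u v, h u - h v ≤ K * dist u v) :
    ∃ φ : TC M →L[ℝ] ℝ, ‖φ‖ ≤ K ∧
      ∀ g : TP M, φ g = Finsupp.linearCombination ℝ h (toFinsupp g) := by
  let L : TP M →L[ℝ] ℝ := LinearMap.mkContinuous
    ((Finsupp.linearCombination ℝ h).comp toFinsupp) K fun g => by
      refine abs_le.mpr ⟨?_, linearCombination_le_mul_norm hK hh g⟩
      have := linearCombination_le_mul_norm hK hh (-g)
      rw [norm_neg, map_neg, map_neg] at this
      simp only [LinearMap.comp_apply]
      linarith
  have hd : DenseRange (Completion.toComplL : TP M →L[ℝ] TC M) := Completion.denseRange_coe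
  have hL : ‖L‖ ≤ K := LinearMap.mkContinuous_norm_le _ hK _
  refine ⟨L.extend Completion.toComplL, ?_, fun g => ?_⟩
  · refine (ContinuousLinearMap.opNorm_extend_le (N := 1) L hd fun x => ?_).trans ?_
    · simp
    · simpa using hL
  · exact ContinuousLinearMap.extend_eq L hd (Completion.isUniformInducing_coe _) g

theorem functional_apply_le {φ : TC M →L[ℝ] ℝ} {K : ℝ} (hφ : ‖φ‖ ≤ K) (f : TC M) :
    |φ f| ≤ K * ‖f‖ := φ.le_of_opNorm_le hφ f

theorem apply_dipole_le {φ : TC M →L[ℝ] ℝ} (hφ : ‖φ‖ ≤ 1) (x y : M) :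
    φ (dipole x y : TP M) ≤ dist x y := by
  have h := functional_apply_le hφ (dipole x y : TP M)
  rw [one_mul, Completion.norm_coe] at h
  exact (le_abs_self _).trans (h.trans (norm_dipole_le x y))

theorem exists_norm_sub_lt (f : TC M) {ε : ℝ} (hε : 0 < ε) : ∃ g : TP M, ‖f - g‖ < ε := by
  obtain ⟨g, hg⟩ := Completion.denseRange_coe.exists_dist_lt f hε
  exact ⟨g, by rwa [← dist_eq_norm]⟩

/-- Converse to `exists_functional`: a functional is recovered from its potential, normalised to
vanish at `o`. -/
theorem apply_coe_eq (φ : TC M →L[ℝ] ℝ) (o : M) (g : TP M) :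
    φ g = Finsupp.linearCombination ℝ (fun u => φ (dipole u o : TP M)) (toFinsupp g) :=
  map_eq_linearCombination (φ.comp Completion.toComplL).toLinearMap o g

theorem apply_dipole_sub (φ : TC M →L[ℝ] ℝ) (x y o : M) :
    φ (dipole x y : TP M) = φ (dipole x o : TP M) - φ (dipole y o : TP M) := by
  rw [apply_coe_eq φ o (dipole x y), toFinsupp_dipole]
  simp

/-- In a uniformly discrete space the indicator of a point is m⁻¹-Lipschitz, so coordinates extend
to the completion. -/
theorem exists_evaluation {m : ℝ} (hm : 0 < m) (hd : ∀ u v : M, u ≠ v → m ≤ dist u v) (x : M) :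
    ∃ φ : TC M →L[ℝ] ℝ, ‖φ‖ ≤ m⁻¹ ∧ ∀ g : TP M, φ g = toFinsupp g x := by
  classical
  obtain ⟨φ, h1, h2⟩ := exists_functional (fun u : M => if u = x then (1 : ℝ) else 0)
    (inv_nonneg.mpr hm.le) (fun u v => by
      rcases eq_or_ne u v with rfl | huv
      · simp
      · have : 1 ≤ m⁻¹ * dist u v := by
          rw [inv_mul_eq_div, one_le_div hm]
          exact hd u v huv
        refine le_trans ?_ this
        split_ifs <;> norm_num)
  refine ⟨φ, h1, fun g => ?_⟩
  rw [h2, Finsupp.linearCombination_apply]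
  simp only [Finsupp.sum, smul_eq_mul, mul_ite, mul_one, mul_zero, Finset.sum_ite_eq',
    Finsupp.mem_support_iff]
  split_ifs with h
  · rfl
  · exact (not_not.mp h).symm

/-- If the metric is equivalent to a sum of weights, then the evaluations at the points of `M`
separate the points of `TC M`. -/
theorem exists_evaluation_ne_zero {w : M → ℝ} {m : ℝ} (hm : 0 < m) (hmw : ∀ u, m ≤ w u)
    (hw : ∀ u v, u ≠ v → w u + w v ≤ dist u v) {o : M} {C : ℝ} (hC : ∀ u, dist u o ≤ C * w u)
    {f : TC M} (hf : f ≠ 0) :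
    ∃ (x : M) (φ : TC M →L[ℝ] ℝ), ‖φ‖ ≤ m⁻¹ ∧ (∀ g : TP M, φ g = toFinsupp g x) ∧ φ f ≠ 0 := by
  classical
  by_contra! hcon
  have hC0 : 0 ≤ C := by
    have h1 := hC o
    have h2 := hmw o
    rw [dist_self] at h1
    exact nonneg_of_mul_nonneg_left h1 (hm.trans_le h2)
  choose E hE1 hE2 using exists_evaluation hm
    (fun u v huv => (by linarith [hmw u, hmw v, hw u v huv] : m ≤ dist u v))
  have hE : ∀ x, E x f = 0 := fun x => hcon x (E x) (hE1 x) (hE2 x)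
  have key : ∀ ε > 0, ‖f‖ ≤ (C + 1) * ε := by
    intro ε hε
    obtain ⟨g, hg⟩ := exists_norm_sub_lt f hε
    set G := toFinsupp g with hG
    -- Since |h| ≤ w, this potential is 1-Lipschitz. Its finite support makes it a combination of
    -- evaluations, which kills `f`, while its value at `g` is the weighted ℓ₁ norm of `g`.
    let h : M → ℝ := fun u => if u ∈ G.support then SignType.sign (G u) * w u else 0
    have habs : ∀ u, |h u| ≤ w u := by
      intro u
      have hwu : 0 ≤ w u := hm.le.trans (hmw u)
      have hs : |((SignType.sign (G u) : SignType) : ℝ)| ≤ 1 := by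
        rcases lt_trichotomy (G u) 0 with h | h | h <;> simp [h]
      simp only [h]
      split_ifs
      · rw [abs_mul, abs_of_nonneg hwu]
        exact mul_le_of_le_one_left hwu hs
      · simpa using hwu
    obtain ⟨φ, hφ1, hφ2⟩ := exists_functional h zero_le_one (fun u v => by
      rcases eq_or_ne u v with rfl | huv
      · simp
      · have h1 := abs_le.mp (habs u)
        have h2 := abs_le.mp (habs v)
        linarith [hw u v huv])
    have hφE : φ = ∑ u ∈ G.support, h u • E u := by
      ext p
      refine Completion.induction_on p (isClosed_eq (by fun_prop) (by fun_prop)) fun q => ?_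
      rw [hφ2, Finsupp.linearCombination_apply,
        Finsupp.sum_of_support_subset _ Finset.subset_union_left (s := (toFinsupp q).support ∪ G.support)
          _ (by simp)]
      simp only [FunLike.coe_sum, Finset.sum_apply, FunLike.coe_smul, Pi.smul_apply, hE2,
        smul_eq_mul]
      symm
      rw [Finset.sum_subset (Finset.subset_union_right (s₁ := (toFinsupp q).support))]
      · exact Finset.sum_congr rfl fun u _ => mul_comm _ _
      · intro u _ hu
        rw [show h u = 0 from if_neg hu, zero_mul]
    have hφf : φ f = 0 := by
      rw [hφE]
      simp [hE]
    have hφg : φ g = ∑ u ∈ G.support, |G u| * w u := by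
      rw [hφ2, Finsupp.linearCombination_apply]
      refine Finset.sum_congr rfl fun u hu => ?_
      simp only [h, hu, if_true, smul_eq_mul]
      rw [← mul_assoc, self_mul_sign]
    have hsmall : φ g ≤ ε := by
      have h1 := functional_apply_le hφ1 (f - g)
      rw [map_sub, hφf, zero_sub, abs_neg, one_mul] at h1
      exact (le_abs_self _).trans (h1.trans hg.le)
    have hgn : ‖g‖ ≤ C * φ g := by
      conv_lhs => rw [eq_sum_dipole g o]
      refine (norm_sum_le _ _).trans ?_
      rw [hφg, Finset.mul_sum]
      refine Finset.sum_le_sum fun u _ => ?_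
      rw [norm_smul, Real.norm_eq_abs]
      calc |G u| * ‖dipole u o‖ ≤ |G u| * (C * w u) :=
            mul_le_mul_of_nonneg_left ((norm_dipole_le _ _).trans (hC u)) (abs_nonneg _)
        _ = _ := by ring
    have h3 : ‖f‖ ≤ ‖f - g‖ + ‖(g : TC M)‖ := by
      simpa using norm_add_le (f - g) (g : TC M)
    rw [Completion.norm_coe] at h3
    nlinarith [mul_le_mul_of_nonneg_left hsmall hC0]
  have hpos : 0 < ‖f‖ := norm_pos_iff.mpr hf
  have := key (‖f‖ / (2 * (C + 1))) (by positivity)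
  have h2 : (C + 1) * (‖f‖ / (2 * (C + 1))) = ‖f‖ / 2 := by field_simp
  linarith

end TC

/-! ### Tight pairs, and the matchings produced by a copy of ℓ₁. -/

namespace TC

open UniformSpace TP Filter Topology

variable {M : Type*} [MetricSpace M]

/-- If `f` has a positive coefficient at `x`, then some pair `x, y` is tight for all the
functionals which attain their norm at `f`. -/
theorem exists_tight_of_evaluation_pos {m : ℝ} (hm : 0 < m)
    (hd : ∀ u v : M, u ≠ v → m ≤ dist u v) {f : TC M} {x : M} {E : TC M →L[ℝ] ℝ}
    (hE : ‖E‖ ≤ m⁻¹) (hEx : ∀ g : TP M, E g = toFinsupp g x) (hf : 0 < E f) :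
    ∃ y, x ≠ y ∧ ∀ φ : TC M →L[ℝ] ℝ, ‖φ‖ ≤ 1 → φ f = ‖f‖ →
      φ (dipole x y : TP M) = dist x y := by
  classical
  by_contra! hcon
  have hex : ∀ y, ∃ φ : TC M →L[ℝ] ℝ, ‖φ‖ ≤ 1 ∧ φ f = ‖f‖ ∧
      (x ≠ y → φ (dipole x y : TP M) < dist x y) := by
    intro y
    rcases eq_or_ne x y with h | h
    · obtain ⟨φ, h1, h2⟩ := exists_dual_vector'' ℝ f
      exact ⟨φ, h1, h2, fun h' => absurd h h'⟩
    · obtain ⟨φ, h1, h2, h3⟩ := hcon y h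
      exact ⟨φ, h1, h2, fun _ => lt_of_le_of_ne (apply_dipole_le h1 x y) h3⟩
  choose Φ hΦ1 hΦ2 hΦ3 using hex
  -- The slack δ found later depends on `g`. This precision still suffices, because the perturbation
  -- `κ` has norm at most δ/m and so changes by at most δ · E f / 4 between `f` and `g`.
  obtain ⟨g, hg⟩ := exists_norm_sub_lt f (show 0 < m * E f / 4 by positivity)
  set S := insert x (toFinsupp g).support with hS
  have hSne : S.Nonempty := ⟨x, by simp [hS]⟩
  have hcard : (0 : ℝ) < S.card := by exact_mod_cast hSne.card_pos
  -- Averaging gives one functional that still norms `f` and is slack on all pairs from `x` into `S`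
  -- at once.
  let φ : TC M →L[ℝ] ℝ := (S.card : ℝ)⁻¹ • ∑ y ∈ S, Φ y
  have hφ_apply : ∀ p, φ p = (S.card : ℝ)⁻¹ * ∑ y ∈ S, Φ y p := fun p => by
    simp [φ]
  have hφ1 : ‖φ‖ ≤ 1 := by
    rw [norm_smul, norm_inv, Real.norm_natCast, inv_mul_le_one₀ hcard]
    refine (norm_sum_le _ _).trans ?_
    simpa using Finset.sum_le_card_nsmul S _ 1 fun y _ => hΦ1 y
  have hφ2 : φ f = ‖f‖ := by
    rw [hφ_apply]
    simp only [hΦ2, Finset.sum_const, nsmul_eq_mul]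
    field_simp
  have hφ3 : ∀ y ∈ S, x ≠ y → φ (dipole x y : TP M) < dist x y := by
    intro y hy hxy
    rw [hφ_apply, inv_mul_lt_iff₀ hcard, ← nsmul_eq_mul, ← Finset.sum_const]
    exact Finset.sum_lt_sum (fun z _ => apply_dipole_le (hΦ1 z) x y) ⟨y, hy, hΦ3 y hxy⟩
  obtain ⟨δ, hδ, hδ0⟩ : ∃ δ : ℝ, (∀ y ∈ S, x ≠ y → φ (dipole x y : TP M) + δ ≤ dist x y) ∧ 0 < δ := by
    have h1 : ∀ᶠ δ : ℝ in 𝓝[>] 0, ∀ y ∈ S, x ≠ y → φ (dipole x y : TP M) + δ ≤ dist x y := by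
      rw [Filter.eventually_all_finset]
      intro y hy
      by_cases hxy : x = y
      · simp [hxy]
      · have h2 : Set.Iio (dist x y - φ (dipole x y : TP M)) ∈ 𝓝[>] (0 : ℝ) :=
          mem_nhdsWithin_of_mem_nhds (Iio_mem_nhds (sub_pos.mpr (hφ3 y hy hxy)))
        filter_upwards [h2] with δ hδ _
        have := Set.mem_Iio.mp hδ
        linarith
    exact (h1.and self_mem_nhdsWithin).exists
  let h : M → ℝ := fun u => φ (dipole u x : TP M)
  have hx : h x = 0 := by
    have := apply_dipole_sub φ x x x
    simp only [sub_self] at this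
    exact this
  have hsub : ∀ u v, φ (dipole u v : TP M) = h u - h v := fun u v => apply_dipole_sub φ u v x
  have hlip : ∀ u v, h u - h v ≤ dist u v := fun u v => hsub u v ▸ apply_dipole_le hφ1 u v
  -- Raise the potential by δ at `x`, keeping it 1-Lipschitz; the slack leaves it unchanged at the
  -- other points of `S`.
  let h' : M → ℝ := fun u => max (h u) (δ - dist x u)
  have hlip' : ∀ u v, h' u - h' v ≤ 1 * dist u v := by
    intro u v
    have h1 : h v ≤ h' v := le_max_left _ _
    have h2 : δ - dist x v ≤ h' v := le_max_right _ _
    have : h' u ≤ h' v + dist u v :=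
      max_le (by linarith [hlip u v]) (by linarith [dist_triangle x u v])
    linarith
  have hle : ∀ u, 0 ≤ h' u - h u := fun u => sub_nonneg.mpr (le_max_left _ _)
  have hge : ∀ u, h' u - h u ≤ δ := by
    intro u
    have h1 := hlip x u
    have : h' u ≤ h u + δ := max_le (by linarith) (by linarith)
    linarith
  obtain ⟨ψ, hψ1, hψ2⟩ := exists_functional h' zero_le_one hlip'
  obtain ⟨κ, hκ1, hκ2⟩ := exists_functional (fun u => h' u - h u)
    (show 0 ≤ δ * m⁻¹ by positivity) (fun u v => by
      rcases eq_or_ne u v with rfl | huv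
      · simp
      · have h1 : 1 ≤ m⁻¹ * dist u v := by
          rw [inv_mul_eq_div, one_le_div hm]
          exact hd u v huv
        have h2 := mul_le_mul_of_nonneg_left h1 hδ0.le
        linarith [hge u, hle v])
  have hκ : κ = ψ - φ := by
    ext p
    refine Completion.induction_on p (isClosed_eq (by fun_prop) (by fun_prop)) fun q => ?_
    rw [sub_apply, hκ2, hψ2, apply_coe_eq φ x]
    simp only [Finsupp.linearCombination_apply, smul_eq_mul, mul_sub, Finsupp.sum,
      Finset.sum_sub_distrib, h]
  have hκg : κ g = δ * toFinsupp g x := by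
    rw [hκ2, Finsupp.linearCombination_apply, Finsupp.sum, Finset.sum_eq_single x]
    · simp only [h', hx, dist_self, sub_zero, max_eq_right hδ0.le, smul_eq_mul]
      ring
    · intro u hu hux
      have h1 := hδ u (Finset.mem_insert_of_mem hu) hux.symm
      rw [hsub, hx] at h1
      have : h' u = h u := max_eq_left (by linarith)
      simp [this]
    · intro hxg
      simp [Finsupp.notMem_support_iff.mp hxg]
  have h1 : κ (g - f) ≤ δ * (E f / 4) := by
    refine (le_abs_self _).trans ((functional_apply_le hκ1 _).trans ?_)
    rw [norm_sub_rev]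
    calc δ * m⁻¹ * ‖f - g‖ ≤ δ * m⁻¹ * (m * E f / 4) := by gcongr
      _ = _ := by field_simp
  have h2 : E (f - g) ≤ E f / 4 := by
    refine (le_abs_self _).trans ((functional_apply_le hE _).trans ?_)
    calc m⁻¹ * ‖f - g‖ ≤ m⁻¹ * (m * E f / 4) := by gcongr
      _ = _ := by field_simp
  -- The new functional cannot exceed ‖f‖, which `φ` already attains; `h1` and `h2` force κ f ≥ δ ·
  -- E f / 2.
  have h3 : κ f ≤ 0 := by
    have := (le_abs_self _).trans (functional_apply_le hψ1 f)
    rw [hκ, sub_apply, hφ2]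
    linarith
  rw [map_sub, hκg] at h1
  rw [map_sub, hEx] at h2
  have h4 : 0 < δ * E f := by positivity
  have h5 : δ * (E f - toFinsupp g x) ≤ δ * (E f / 4) := mul_le_mul_of_nonneg_left h2 hδ0.le
  linarith

/-- Every nonzero `f` has a pair `x ≠ y` which is tight for all the functionals attaining their
norm at `f`. -/
theorem exists_tight {w : M → ℝ} {m : ℝ} (hm : 0 < m) (hmw : ∀ u, m ≤ w u)
    (hw : ∀ u v, u ≠ v → w u + w v ≤ dist u v) {o : M} {C : ℝ} (hC : ∀ u, dist u o ≤ C * w u)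
    {f : TC M} (hf : f ≠ 0) :
    ∃ x y, x ≠ y ∧ ∀ φ : TC M →L[ℝ] ℝ, ‖φ‖ ≤ 1 → φ f = ‖f‖ →
      φ (dipole x y : TP M) = dist x y := by
  have hd : ∀ u v : M, u ≠ v → m ≤ dist u v := fun u v huv => by
    linarith [hmw u, hmw v, hw u v huv]
  obtain ⟨x, E, hE, hEx, hne⟩ := exists_evaluation_ne_zero hm hmw hw hC hf
  rcases lt_or_gt_of_ne hne with hlt | hgt
  -- For a negative coefficient, pass to `-f` and reverse the pair.
  · obtain ⟨y, hxy, hy⟩ := exists_tight_of_evaluation_pos hm hd (f := -f) hE hEx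
      (by rw [map_neg]; linarith)
    refine ⟨y, x, hxy.symm, fun φ h1 h2 => ?_⟩
    have := hy (-φ) (by rwa [norm_neg]) (by simpa using h2)
    rw [neg_apply, apply_dipole_sub φ x y x, apply_dipole_sub φ x x x] at this
    rw [apply_dipole_sub φ y x x, dist_comm, apply_dipole_sub φ x x x]
    linarith
  · obtain ⟨y, hxy, hy⟩ := exists_tight_of_evaluation_pos hm hd hE hEx hgt
    exact ⟨x, y, hxy, hy⟩

/-- An isometric copy of `ℓ₁` in `TC M` yields a sequence of pairs of points, any two of which form
a matching of minimal weight. -/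
theorem exists_minimal_matchings {w : M → ℝ} {m : ℝ} (hm : 0 < m) (hmw : ∀ u, m ≤ w u)
    (hw : ∀ u v, u ≠ v → w u + w v ≤ dist u v) {o : M} {C : ℝ} (hC : ∀ u, dist u o ≤ C * w u)
    (T : lp (fun _ : ℕ => ℝ) 1 →ₗᵢ[ℝ] TC M) :
    ∃ x y : ℕ → M, (∀ i, x i ≠ y i) ∧ ∀ i j, i ≠ j →
      dist (x i) (y i) + dist (x j) (y j) ≤ dist (x i) (y j) + dist (x j) (y i) ∧
      dist (x i) (y i) + dist (x j) (y j) ≤ dist (x i) (x j) + dist (y i) (y j) := by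
  classical
  let e : ℕ → lp (fun _ : ℕ => ℝ) 1 := fun i => lp.single 1 i (1 : ℝ)
  have he : ∀ i, ‖T (e i)‖ = 1 := fun i => by
    rw [T.norm_map, lp.norm_single one_pos]
    simp
  have hes : ∀ i j, i ≠ j → ∀ s : ℝ, |s| = 1 → ‖T (e i) + s • T (e j)‖ = 2 := by
    intro i j hij s hs
    have h1 := lp.norm_sum_single (E := fun _ : ℕ => ℝ) (p := 1) (by simp)
      (fun k => if k = j then s else 1) {i, j}
    rw [Finset.sum_pair hij, Finset.sum_pair hij] at h1
    simp only [hij, if_false, if_true, ENNReal.toReal_one, Real.rpow_one, Real.norm_eq_abs, hs,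
      abs_one] at h1
    have h2 : lp.single (E := fun _ : ℕ => ℝ) 1 j s = s • e j := by
      rw [← lp.single_smul, smul_eq_mul, mul_one]
    rw [← map_smul, ← map_add, T.norm_map, ← h2]
    exact h1.trans (by norm_num)
  have hT : ∀ i, T (e i) ≠ 0 := fun i h0 => by
    have := he i
    rw [h0, norm_zero] at this
    exact zero_ne_one this
  choose x y hxy ht using fun i => exists_tight hm hmw hw hC (hT i)
  -- A functional attaining the norm 2 = 1 + 1 of the sum must norm each summand.
  have hex : ∀ i j, i ≠ j → ∀ s : ℝ, |s| = 1 → ∃ φ : TC M →L[ℝ] ℝ, ‖φ‖ ≤ 1 ∧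
      φ (dipole (x i) (y i) : TP M) = dist (x i) (y i) ∧
      s * φ (dipole (x j) (y j) : TP M) = dist (x j) (y j) := by
    intro i j hij s hs
    obtain ⟨φ, h1, h2⟩ := exists_dual_vector'' ℝ (T (e i) + s • T (e j))
    have hsφ : ‖s • φ‖ ≤ 1 := by rw [norm_smul, Real.norm_eq_abs, hs, one_mul]; exact h1
    rw [hes i j hij s hs, map_add, map_smul, smul_eq_mul] at h2
    have h3 := (le_abs_self _).trans (functional_apply_le h1 (T (e i)))
    have h4 := (le_abs_self _).trans (functional_apply_le hsφ (T (e j)))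
    rw [he] at h3 h4
    rw [smul_apply, smul_eq_mul] at h4
    simp only [RCLike.ofReal_real_eq_id, id] at h2
    exact ⟨φ, h1, ht i φ h1 (by rw [he]; linarith),
      ht j (s • φ) hsφ (by rw [he, smul_apply, smul_eq_mul]; linarith)⟩
  refine ⟨x, y, hxy, fun i j hij => ⟨?_, ?_⟩⟩
  · obtain ⟨φ, h1, h2, h3⟩ := hex i j hij 1 (by simp)
    have h4 := apply_dipole_le h1 (x i) (y j)
    have h5 := apply_dipole_le h1 (x j) (y i)
    rw [apply_dipole_sub φ _ _ o] at h2 h3 h4 h5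
    linarith
  -- The sign -1 exchanges the roles of `x j` and `y j`, which gives the other rival matching.
  · obtain ⟨φ, h1, h2, h3⟩ := hex i j hij (-1) (by simp)
    have h4 := apply_dipole_le h1 (x i) (x j)
    have h5 := apply_dipole_le h1 (y j) (y i)
    rw [dist_comm (y j)] at h5
    rw [apply_dipole_sub φ _ _ o] at h2 h3 h4 h5
    linarith

end TC

/-! ### Matchings in the five spaces. -/

namespace CJSpace

/-- Each `rho` splits as p(k) + q(n), so the terms in `a` and `d` cancel. What remains is that p - q
is strictly increasing, which holds in all five cases. -/
theorem rho_separated (l : CJLabel) {a b c d : ℕ+} (hbc : b < c) :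
    l.rho a c + l.rho b d < l.rho a b + l.rho c d := by
  have hb : (0 : ℝ) < b := by exact_mod_cast b.pos
  have h : 1 / (c : ℝ) < 1 / b := one_div_lt_one_div_of_lt hb (by exact_mod_cast hbc)
  cases l <;> simp only [CJLabel.rho, one_div, mul_inv] at * <;> linarith

/-- The three strict triangle inequalities for `v_i, v_j, v_k` with `i < j < k`. -/
theorem rho_triangle_strict (l : CJLabel) {i j k : ℕ+} (hij : i < j) (hjk : j < k) :
    l.rho i k < l.rho i j + l.rho j k ∧ l.rho i j < l.rho i k + l.rho j k ∧
      l.rho j k < l.rho i j + l.rho i k := by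
  have hi : (1 : ℝ) ≤ i := by exact_mod_cast one_le (a := i)
  have hij1 : (i : ℝ) + 1 ≤ j := by exact_mod_cast hij
  have hjk1 : (j : ℝ) + 1 ≤ k := by exact_mod_cast hjk
  have hi' : 1 / (i : ℝ) ≤ 1 := by rw [div_le_one (by linarith)]; exact hi
  have hj' : 1 / (j : ℝ) ≤ 1 / 2 := one_div_le_one_div_of_le (by norm_num) (by linarith)
  have hij' : 1 / (j : ℝ) < 1 / i := one_div_lt_one_div_of_lt (by linarith) (by linarith)
  have hjk' : 1 / (k : ℝ) < 1 / j := one_div_lt_one_div_of_lt (by linarith) (by linarith)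
  have hk0 : 0 < 1 / (k : ℝ) := by positivity
  cases l <;> simp only [CJLabel.rho, one_div, mul_inv] at * <;>
    refine ⟨?_, ?_, ?_⟩ <;> linarith

theorem dist_triangle_strict {l : CJLabel} {p q r : CJSpace l} (hpq : p ≠ q) (hqr : q ≠ r) :
    dist p r < dist p q + dist q r := by
  rcases eq_or_ne p r with rfl | hpr
  · rw [dist_self]
    linarith [dist_pos.mpr hpq, dist_pos.mpr hqr]
  obtain ⟨p⟩ := p
  obtain ⟨q⟩ := q
  obtain ⟨r⟩ := r
  have hpq' : p ≠ q := fun h => hpq (by rw [h])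
  have hqr' : q ≠ r := fun h => hqr (by rw [h])
  have hpr' : p ≠ r := fun h => hpr (by rw [h])
  rcases lt_or_gt_of_ne hpq' with h1 | h1 <;> rcases lt_or_gt_of_ne hqr' with h2 | h2 <;>
    rcases lt_or_gt_of_ne hpr' with h3 | h3
  · rw [dist_of_lt l h1, dist_of_lt l h2, dist_of_lt l h3]
    exact (rho_triangle_strict l h1 h2).1
  · exact absurd (h1.trans h2) h3.not_gt
  · rw [dist_of_lt l h1, dist_comm (v q), dist_of_lt l h2, dist_of_lt l h3]
    exact (rho_triangle_strict l h3 h2).2.1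
  · rw [dist_of_lt l h1, dist_comm (v q), dist_of_lt l h2, dist_comm, dist_of_lt l h3]
    linarith [(rho_triangle_strict l h3 h1).2.1]
  · rw [dist_comm (v p) (v q), dist_of_lt l h1, dist_of_lt l h2, dist_of_lt l h3]
    exact (rho_triangle_strict l h1 h3).2.2
  · rw [dist_comm (v p) (v q), dist_of_lt l h1, dist_of_lt l h2, dist_comm, dist_of_lt l h3]
    linarith [(rho_triangle_strict l h2 h3).2.2]
  · exact absurd (h2.trans h1) h3.not_gt
  · rw [dist_comm (v p) (v q), dist_of_lt l h1, dist_comm (v q), dist_of_lt l h2, dist_comm,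
      dist_of_lt l h3]
    linarith [(rho_triangle_strict l h2 h1).1]

theorem dist_separated {l : CJLabel} {a b c d : CJSpace l} (hab : a.idx < b.idx)
    (hbc : b.idx < c.idx) (hcd : c.idx < d.idx) :
    dist a c + dist b d < dist a b + dist c d := by
  have h := rho_separated l (a := a.idx) (d := d.idx) hbc
  rw [← dist_of_lt l hab, ← dist_of_lt l hcd, ← dist_of_lt l (hab.trans hbc),
    ← dist_of_lt l (hbc.trans hcd)] at h
  exact h

/-- A weight function to which the metric of `CJSpace l` is comparable. -/
def weight (l : CJLabel) (p : CJSpace l) : ℝ :=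
  match l with
  -- Only this metric is unbounded, so its weight must grow with the index to control the distance
  -- to `v 1`.
  | .a => (p.idx : ℝ) / 2
  -- Half of 3/4, the distance from `v 1` to `v 2` in case (c) and the smallest one in the bounded
  -- cases.
  | _ => 3 / 8

theorem weight_ge (l : CJLabel) (p : CJSpace l) : 3 / 8 ≤ weight l p := by
  have hp : (1 : ℝ) ≤ p.idx := by exact_mod_cast one_le (a := p.idx)
  cases l <;> simp only [weight] <;> linarith

theorem weight_add_le (l : CJLabel) {p q : CJSpace l} (hpq : p ≠ q) :
    weight l p + weight l q ≤ dist p q := by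
  have key : ∀ p q : CJSpace l, p.idx < q.idx → weight l p + weight l q ≤ dist p q := by
    rintro ⟨k⟩ ⟨n⟩ h
    change k < n at h
    rw [dist_of_lt l h]
    have hk : (1 : ℝ) ≤ k := by exact_mod_cast one_le (a := k)
    have hkn : (k : ℝ) + 1 ≤ n := by exact_mod_cast h
    have hk' : 1 / (k : ℝ) ≤ 1 := by rw [div_le_one (by linarith)]; exact hk
    have hn' : 1 / (n : ℝ) ≤ 1 / 2 := one_div_le_one_div_of_le (by norm_num) (by linarith)
    have hk0 : 0 < 1 / (k : ℝ) := by positivity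
    have hn0 : 0 < 1 / (n : ℝ) := by positivity
    cases l <;> simp only [weight, CJLabel.rho, one_div, mul_inv] at * <;> linarith
  rcases lt_trichotomy p.idx q.idx with h | h | h
  · exact key p q h
  · cases p; cases q; exact absurd (congrArg v h) hpq
  · rw [dist_comm, add_comm]
    exact key q p h

theorem dist_one_le (l : CJLabel) (p : CJSpace l) : dist p (v 1) ≤ 8 * weight l p := by
  obtain ⟨n⟩ := p
  rcases eq_or_ne n 1 with rfl | hn
  · rw [dist_self]
    linarith [weight_ge l (v 1)]
  · have h : 1 < n := lt_of_le_of_ne (one_le (a := n)) hn.symm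
    rw [dist_comm, dist_of_lt l h]
    have hn1 : (1 : ℝ) ≤ n := by exact_mod_cast one_le (a := n)
    have hn' : 1 / (n : ℝ) ≤ 1 := by rw [div_le_one (by linarith)]; exact hn1
    have hn0 : 0 < 1 / (n : ℝ) := by positivity
    cases l <;> simp only [weight, CJLabel.rho, one_div, mul_inv, PNat.one_coe, Nat.cast_one,
      inv_one] at * <;> linarith

theorem finite_idx_le (l : CJLabel) (N : ℕ+) : {p : CJSpace l | p.idx ≤ N}.Finite := by
  refine ((Set.finite_Iic N).image (v (l := l))).subset ?_
  rintro ⟨k⟩ hk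
  exact ⟨k, hk, rfl⟩

theorem not_minimal_matchings {l : CJLabel} {x y : ℕ → CJSpace l} (hxy : ∀ i, x i ≠ y i)
    (h : ∀ i j, i ≠ j →
      dist (x i) (y i) + dist (x j) (y j) ≤ dist (x i) (y j) + dist (x j) (y i) ∧
      dist (x i) (y i) + dist (x j) (y j) ≤ dist (x i) (x j) + dist (y i) (y j)) : False := by
  -- If `x i = x j`, the rival matching costs only the distance from `y i` to `y j`, contradicting
  -- the strict triangle inequality.
  have hx : Function.Injective x := by
    intro i j hij
    by_contra hne
    have h1 := (h i j hne).2
    have h2 := dist_triangle_strict (hij ▸ (hxy i).symm : y i ≠ x j) (hxy j)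
    rw [hij, dist_self, dist_comm (x j) (y i)] at h1
    linarith
  have hy : Function.Injective y := by
    intro i j hij
    by_contra hne
    have h1 := (h i j hne).2
    have h2 := dist_triangle_strict (hij ▸ hxy i : x i ≠ y j) (hxy j).symm
    rw [hij, dist_self, dist_comm (x j) (y j)] at h1
    linarith
  -- By injectivity only finitely many pairs meet the indices up to `N`, so some pair `i` lies
  -- wholly beyond pair 0.
  let N : ℕ+ := max (x 0).idx (y 0).idx
  have hfx := (finite_idx_le l N).preimage hx.injOn
  have hfy := (finite_idx_le l N).preimage hy.injOn
  obtain ⟨i, hi⟩ := (hfx.union hfy).exists_notMem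
  simp only [Set.mem_union, Set.mem_preimage, Set.mem_ofPred_eq, not_or, not_le, N,
    max_lt_iff] at hi
  obtain ⟨⟨h1, h2⟩, h3, h4⟩ := hi
  have h0i : 0 ≠ i := by
    rintro rfl
    exact lt_irrefl _ h1
  obtain ⟨hA, hB⟩ := h 0 i h0i
  have hidx : ∀ k, (x k).idx ≠ (y k).idx := fun k hk => hxy k (by
    cases hp : x k; cases hq : y k
    rw [hp, hq] at hk
    exact congrArg v hk)
  -- The orientations of the two pairs decide which of `hA` and `hB` concerns the interlaced
  -- matching.
  rcases lt_or_gt_of_ne (hidx 0) with h5 | h5 <;> rcases lt_or_gt_of_ne (hidx i) with h6 | h6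
  · linarith [dist_separated h5 h2 h6]
  · have := dist_separated h5 h4 h6
    rw [dist_comm (y 0) (x i), dist_comm (y i) (x i)] at this
    linarith
  · have := dist_separated h5 h1 h6
    rw [dist_comm (y 0) (x i), dist_comm (y 0) (x 0)] at this
    linarith
  · have := dist_separated h5 h3 h6
    rw [dist_comm (y 0) (x 0), dist_comm (y i) (x i)] at this
    linarith

end CJSpace

end

/-- For each of the five spaces `M`, the transportation cost space of `M` contains no (linear)
isometric copy of the real Banach space `ℓ₁`. -/
theorem mainTheorem2 (l : CJLabel) :
    IsEmpty (lp (fun _ : ℕ => ℝ) 1 →ₗᵢ[ℝ] TC (CJSpace l)) := by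
  refine ⟨fun T => ?_⟩
  obtain ⟨x, y, hxy, h⟩ := TC.exists_minimal_matchings (by norm_num) (CJSpace.weight_ge l)
    (fun _ _ => CJSpace.weight_add_le l) (CJSpace.dist_one_le l) T
  exact CJSpace.not_minimal_matchings hxy h
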